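/- **Theorem.** Let $d\ge 3$ be an integer and let $l>0$, $\mu>0$ be such that $$V(r)=1-\frac{\mu}{r^{d-2}}-\frac{r^2}{l^2}$$ has at least two distinct positive zeros; let $r_c>r_b>0$ be the largest two. Let $(M,g)$ be the $(d+1)$-dimensional Schwarzschild–de Sitter spacetime $$g=V(r)\,dt^2-\frac{dr^2}{V(r)}-r^2\,d\Omega_{d-1}^2$$ of positive mass outside the black hole horizon, i.e. the region $r>r_b$ extended through the bifurcate cosmological horizon $r=r_c$: it consists of two static blocks $r_b<r<r_c$, a past and a future cosmological block $r>r_c$, and the horizons $r=r_c$ that separate them. Explicitly, with $\kappa=-\tfrac12V'(r_c)>0$, $$M=\{(x,y,\omega)\in\mathbb R^2\times S^{d-1}:\ 0<\tfrac1r<\tfrac1{r_b}\},\qquad \frac1r=\frac1{r_c}-xy,\qquad g=r^2\Big(\frac{2}{\kappa}\,dx\,dy+\frac{H(1/r)}{\kappa^{2}}\,y^2\,dx^2-d\Omega_{d-1}^2\Big),$$ where $H$ is the polynomial with $H(u)\,(u-\tfrac1{r_c})^2=u^2V(1/u)-2\kappa\,(u-\tfrac1{r_c})$, and $M$ is time-oriented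 so that $dx>0$ on future-directed timelike vectors; off the horizons this is the metric above, with $x=\pm e^{\kappa(t-\rho(r))}$ and $d\rho/dr=1/V$. Let $\tilde M\supset M$ be the conformal compactification at $r=\infty$, with metric $\tilde g=r^{-2}g$, which extends smoothly to the conformal boundary $\{1/r=0\}=\mathcal I^-\cup\mathcal I^+$; here $\mathcal I^-$ (where $x<0$) bounds the past and $\mathcal I^+$ (where $x>0$) the future cosmological block. Then $(M,g)$ satisfies the Penrose property: for all $p\in\mathcal I^-$ and $q\in\mathcal I^+$ there is a smooth future-directed curve from $p$ to $q$ in $\tilde M$, timelike for $\tilde g$ (including at its endpoints) and lying in $M$ except for its endpoints. -/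

import Mathlib

namespace SdS

open scoped ContDiff

/-- The function `V(r) = 1 - μ / r^(d-2) - r² / l²` in the Schwarzschild-de Sitter line element
`ds² = V(r) dt² - dr² / V(r) - r² dΩ²_{d-1}` on a spacetime of dimension `d + 1`
(signature `(+,-,…,-)`). -/
noncomputable def V (d : ℕ) (l μ r : ℝ) : ℝ :=
  1 - μ / r ^ (d - 2) - r ^ 2 / l ^ 2

/-- The Schwarzschild-de Sitter line element in static coordinates, at radius `r`, evaluated on
the velocity with components `dt`, `dr` and `dω`; here `dω` is tangent to the unit sphere
of `ℝ^d`, so `‖dω‖²` is the round line element. -/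
noncomputable def staticMetric (d : ℕ) (l μ r dt dr : ℝ) (dω : EuclideanSpace ℝ (Fin d)) : ℝ :=
  V d l μ r * dt ^ 2 - dr ^ 2 / V d l μ r - r ^ 2 * ‖dω‖ ^ 2

/-- The surface gravity `-V'(rc) / 2` of the cosmological horizon `r = rc`. -/
noncomputable def kappa (d : ℕ) (l μ rc : ℝ) : ℝ :=
  rc / l ^ 2 - (d - 2) * μ / (2 * rc ^ (d - 1))

/-- The ambient space of the extended spacetime: horizon-regular coordinates `(x, y)` and the
linear space containing the unit sphere `S^{d-1}` of the angular variable `ω`. -/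
abbrev Ambient (d : ℕ) : Type := ℝ × ℝ × EuclideanSpace ℝ (Fin d)

/-- The conformal factor `1 / r`, as a function of the horizon-regular coordinates:
`1 / r = 1 / rc - x y`. The two horizons `r = rc` are `x = 0` and `y = 0`, which cross in the
bifurcation sphere `x = y = 0`; `r > rc` is `x y > 0`, and `r = ∞` is `x y = 1 / rc`. -/
noncomputable def invR {d : ℕ} (rc : ℝ) (p : Ambient d) : ℝ :=
  1 / rc - p.1 * p.2.1

/-- With `W(u) = u² V(1/u) = u² - μ u^d - 1/l²` and `c = 1 / rc` (so that `W(c) = 0` and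
`W'(c) = 2 κ`), this is the polynomial `(W(u) - 2 κ (u - c)) / (u - c)²`. -/
noncomputable def H (d : ℕ) (μ rc u : ℝ) : ℝ :=
  1 - μ * ∑ k ∈ Finset.range (d - 1), ((k : ℝ) + 1) * (1 / rc) ^ k * u ^ (d - 2 - k)

/-- The conformally rescaled line element `g̃ = r⁻² g` of the extended spacetime at the point `p`,
evaluated on the velocity `v = (dx, dy, dω)`:
`g̃ = (2 / κ) dx dy + κ⁻² H(1/r) y² dx² - dω²`. It is polynomial in the coordinates, hence
smooth across the horizons and up to `r = ∞`. -/
noncomputable def conformalMetric (d : ℕ) (l μ rc : ℝ) (p v : Ambient d) : ℝ :=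
  2 / kappa d l μ rc * v.1 * v.2.1
    + H d μ rc (invR rc p) * p.2.1 ^ 2 * v.1 ^ 2 / kappa d l μ rc ^ 2 - ‖v.2.2‖ ^ 2

/-- The physical line element `g = r² g̃`, at points where `1 / r ≠ 0`. -/
noncomputable def metric (d : ℕ) (l μ rc : ℝ) (p v : Ambient d) : ℝ :=
  (invR rc p)⁻¹ ^ 2 * conformalMetric d l μ rc p v

/-- The exterior region `r > rb` of the Schwarzschild-de Sitter spacetime, extended across the
cosmological horizon `r = rc`: two static blocks `rb < r < rc` (where `x y < 0`), the past
(`x, y < 0`) and the future (`x, y > 0`) cosmological blocks `r > rc`, the two horizons and their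
bifurcation sphere. -/
def spacetime (d : ℕ) (rb rc : ℝ) : Set (Ambient d) :=
  {p | 0 < invR rc p ∧ invR rc p < 1 / rb ∧ ‖p.2.2‖ = 1}

/-- Past null infinity: the component of the conformal boundary `1 / r = 0` that bounds the past
cosmological block. -/
def scriMinus (d : ℕ) (rc : ℝ) : Set (Ambient d) :=
  {p | invR rc p = 0 ∧ p.1 < 0 ∧ ‖p.2.2‖ = 1}

/-- Future null infinity: the component of the conformal boundary `1 / r = 0` that bounds the
future cosmological block. -/
def scriPlus (d : ℕ) (rc : ℝ) : Set (Ambient d) :=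
  {p | invR rc p = 0 ∧ 0 < p.1 ∧ ‖p.2.2‖ = 1}

/-- The conformal compactification (at `r = ∞`) of the spacetime. -/
def compactification (d : ℕ) (rb rc : ℝ) : Set (Ambient d) :=
  spacetime d rb rc ∪ (scriMinus d rc ∪ scriPlus d rc)

/-- A velocity `v` at `p` is future-directed timelike: `g̃(v, v) > 0`, and `v` lies on the same side
as the nowhere vanishing null field `∂_y`, which is taken to be future-directed; as
`g̃(v, ∂_y) = dx / κ`, with `κ > 0`, the latter says `dx > 0`. -/
def IsFutureTimelike (d : ℕ) (l μ rc : ℝ) (p v : Ambient d) : Prop :=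
  0 < conformalMetric d l μ rc p v ∧ 0 < v.1

/-- `γ : [0,1] → M̃` is a smooth future-directed timelike curve from `p` to `q` in the
compactification. It is timelike at its endpoints too, and all its other points lie in the
physical spacetime. -/
structure IsTimelikeCurve (d : ℕ) (l μ rb rc : ℝ) (γ : ℝ → Ambient d) (p q : Ambient d) :
    Prop where
  smooth : ContDiffOn ℝ ∞ γ (Set.Icc 0 1)
  source : γ 0 = p
  target : γ 1 = q
  mem : ∀ s ∈ Set.Icc (0 : ℝ) 1, γ s ∈ compactification d rb rc
  mem_spacetime : ∀ s ∈ Set.Ioo (0 : ℝ) 1, γ s ∈ spacetime d rb rc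
  timelike : ∀ s ∈ Set.Icc (0 : ℝ) 1,
    IsFutureTimelike d l μ rc (γ s) (derivWithin γ (Set.Icc 0 1) s)

/-- The Penrose property: every point of past null infinity can be joined to every point of future
null infinity by a smooth (future-directed) timelike curve. -/
def PenroseProperty (d : ℕ) (l μ rb rc : ℝ) : Prop :=
  ∀ p ∈ scriMinus d rc, ∀ q ∈ scriPlus d rc,
    ∃ γ : ℝ → Ambient d, IsTimelikeCurve d l μ rb rc γ p q

/-! The facts below show that the extended metric is the Schwarzschild-de Sitter metric. -/

theorem hasDerivAt_V {d : ℕ} (hd : 3 ≤ d) {l μ rc : ℝ} (hrc : 0 < rc) :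
    HasDerivAt (V d l μ) (-2 * kappa d l μ rc) rc := by
  obtain ⟨n, rfl⟩ : ∃ n, d = n + 3 := ⟨d - 3, by omega⟩
  have h1 : HasDerivAt (fun r : ℝ => r ^ (n + 1)) (((n + 1 : ℕ) : ℝ) * rc ^ n) rc := by
    simpa using hasDerivAt_pow (n + 1) rc
  have h2 : HasDerivAt (fun r : ℝ => r ^ 2) (2 * rc) rc := by
    simpa using hasDerivAt_pow 2 rc
  have h3 := (((hasDerivAt_const rc μ).div h1 (by positivity)).const_sub 1).sub
    (h2.div_const (l ^ 2))
  have e : n + 3 - 2 = n + 1 := by omega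
  have e' : n + 3 - 1 = n + 2 := by omega
  refine (h3.congr_deriv ?_).congr_of_eventuallyEq (Filter.Eventually.of_forall fun r => ?_)
  · unfold kappa
    rw [e']
    push_cast
    by_cases hl : l = 0
    · subst hl
      field_simp
      simp
      ring
    · field_simp
      ring
  · simp only [V, e]
    rfl

theorem H_mul_sq {d : ℕ} (hd : 3 ≤ d) {l μ rc : ℝ} (hrc : 0 < rc) (hV : V d l μ rc = 0) {u : ℝ}
    (hu : 0 < u) :
    H d μ rc u * (u - 1 / rc) ^ 2
      = u ^ 2 * V d l μ (1 / u) - 2 * kappa d l μ rc * (u - 1 / rc) := by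
  have key : ∀ (n : ℕ) (c w : ℝ),
      (∑ k ∈ Finset.range (n + 1), ((k : ℝ) + 1) * c ^ k * w ^ (n - k)) * (w - c) ^ 2
        = w ^ (n + 2) - (n + 2) * c ^ (n + 1) * w + (n + 1) * c ^ (n + 2) := by
    intro n c w
    induction n with
    | zero => simp; ring
    | succ n ih =>
      have hs : ∑ k ∈ Finset.range (n + 1), ((k : ℝ) + 1) * c ^ k * w ^ (n + 1 - k)
          = w * ∑ k ∈ Finset.range (n + 1), ((k : ℝ) + 1) * c ^ k * w ^ (n - k) := by
        rw [Finset.mul_sum]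
        refine Finset.sum_congr rfl fun k hk => ?_
        have : n + 1 - k = (n - k) + 1 := by
          have := Finset.mem_range.1 hk
          omega
        rw [this, pow_succ]
        ring
      rw [Finset.sum_range_succ, hs, add_mul, mul_assoc, ih]
      push_cast
      simp only [Nat.sub_self, pow_zero]
      ring
  obtain ⟨n, rfl⟩ : ∃ n, d = n + 3 := ⟨d - 3, by omega⟩
  have e : n + 3 - 2 = n + 1 := by omega
  have e' : n + 3 - 1 = n + 2 := by omega
  have k := key (n + 1) (1 / rc) u
  unfold V at hV
  unfold H V kappa
  rw [e] at hV
  rw [e, e', sub_mul, mul_assoc, k]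
  have hl : (l ^ 2)⁻¹ = (1 - μ / rc ^ (n + 1)) / rc ^ 2 := by
    rw [eq_div_iff (by positivity)]
    linear_combination -hV
  simp only [div_eq_mul_inv _ (l ^ 2), hl]
  push_cast
  simp only [one_div, inv_pow]
  field_simp
  ring

/-- Let `ρ` be a tortoise coordinate, `dρ/dr = 1 / V`. On each of the four blocks the map
`(t, r, θ) ↦ (x, y, θ)`, `θ` on the unit sphere, with `x = ε e^{κ (t - ρ(r))}`, `ε = ±1`, and `1 / r = 1 / rc - x y` pulls
the metric `g` back to the Schwarzschild-de Sitter metric. The sign `ε` and the sign of `r - rc`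
select the block; `t` and `r` are recovered from `x` and `y`. -/
theorem metric_eq_staticMetric {d : ℕ} (hd : 3 ≤ d) {l μ rc : ℝ} (hrc : 0 < rc)
    (hV : V d l μ rc = 0) (hκ : kappa d l μ rc ≠ 0) {ε : ℝ} (hε : ε = 1 ∨ ε = -1)
    {ρ t r : ℝ → ℝ} {θ : ℝ → EuclideanSpace ℝ (Fin d)} {s dt dr : ℝ}
    {dθ : EuclideanSpace ℝ (Fin d)} (hr : 0 < r s) (hVr : V d l μ (r s) ≠ 0)
    (hρ : HasDerivAt ρ (1 / V d l μ (r s)) (r s)) (ht : HasDerivAt t dt s)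
    (hr' : HasDerivAt r dr s) (hθ : HasDerivAt θ dθ s) :
    ∃ γ : ℝ → Ambient d, ∃ v : Ambient d,
      (∀ a, γ a = (ε * Real.exp (kappa d l μ rc * (t a - ρ (r a))),
        (1 / rc - 1 / r a) / (ε * Real.exp (kappa d l μ rc * (t a - ρ (r a)))), θ a)) ∧
      (∀ a, invR rc (γ a) = 1 / r a) ∧
      HasDerivAt γ v s ∧
      metric d l μ rc (γ s) v = staticMetric d l μ (r s) dt dr dθ := by
  set κ := kappa d l μ rc with hκdef
  have hε0 : ε ≠ 0 := by rcases hε with h | h <;> rw [h] <;> norm_num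
  have hx0 : ∀ a, ε * Real.exp (κ * (t a - ρ (r a))) ≠ 0 := fun a =>
    mul_ne_zero hε0 (Real.exp_ne_zero _)
  have hx : HasDerivAt (fun a => ε * Real.exp (κ * (t a - ρ (r a))))
      (ε * (Real.exp (κ * (t s - ρ (r s))) * (κ * (dt - 1 / V d l μ (r s) * dr)))) s :=
    (((ht.sub (hρ.comp s hr')).const_mul κ).exp).const_mul ε
  have hu : HasDerivAt (fun a => 1 / rc - 1 / r a) (dr / r s ^ 2) s := by
    have := (hr'.inv hr.ne').const_sub (1 / rc)
    simp only [one_div] at this ⊢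
    exact this.congr_deriv (by ring)
  have hy := hu.div hx (hx0 s)
  have hinv : ∀ a, invR rc ((ε * Real.exp (κ * (t a - ρ (r a))),
        (1 / rc - 1 / r a) / (ε * Real.exp (κ * (t a - ρ (r a)))), θ a) : Ambient d)
        = 1 / r a := by
    intro a
    simp only [invR]
    rw [mul_div_cancel₀ _ (hx0 a)]
    ring
  refine ⟨_, _, fun a => rfl, hinv, hx.prodMk (hy.prodMk hθ), ?_⟩
  have hH := H_mul_sq hd hrc hV (u := 1 / r s) (by positivity)
  simp only [one_div_one_div] at hH
  simp only [metric, conformalMetric, hinv, staticMetric]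
  rw [← hκdef] at hH ⊢
  have hX := hx0 s
  have hE : ε * Real.exp (κ * (t s - ρ (r s))) ≠ 0 := hX
  have hv : ∀ A : ℝ, ε * (Real.exp (κ * (t s - ρ (r s))) * A)
      = (ε * Real.exp (κ * (t s - ρ (r s)))) * A := fun A => by ring
  rw [hv]
  generalize ε * Real.exp (κ * (t s - ρ (r s))) = X at hX
  generalize V d l μ (r s) = w at hH hVr ⊢
  generalize H d μ rc (1 / r s) = h at hH ⊢
  generalize r s = R at hr hH ⊢
  have hH' : h * (1 / rc - 1 / R) ^ 2 = (1 / R) ^ 2 * w - 2 * κ * (1 / R - 1 / rc) := by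
    rw [← hH]; ring
  have hR := hr.ne'
  have hterm : h * ((1 / rc - 1 / R) / X) ^ 2 * (X * (κ * (dt - 1 / w * dr))) ^ 2 / κ ^ 2
      = (h * (1 / rc - 1 / R) ^ 2) * (dt - 1 / w * dr) ^ 2 := by
    field_simp
  rw [hterm, hH']
  field_simp
  ring

end SdS

/-!
Write `u = 1 / r`, `c = 1 / rc`, `b = 1 / rb` and `W(u) = u² V(1/u) = u² - μ u^d - 1/l²`, so that the
conformal metric is `W dt² - du² / W - dω²` and `W(c) = W(b) = 0`.

In de Sitter space (`μ = 0`) the light rays from a point of past null infinity all refocus at one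
antipodal point of future null infinity, after turning by the angle `π`: they are `u = a sin θ`,
`dt/dθ = E / W(u)` with `E² = a² - c²`, where `θ` is the angle along a great circle. No timelike
curve reaches that point. For `μ > 0` the very same formulas (with `c`, `W` those of
the black hole) give a curve with
`g̃(γ', γ') = μ (u^d - c^d) / W(u) = (u + c) / G(u) - 1`, `G(u) = W(u) / (u - c)`,
and this is positive because `0 < G(u) < u + c` on `[0, b)` (`radialSlope_pos`, `radialSlope_lt`).
So positive mass makes the curve timelike, up to and including both null infinities, while it turns
by `π`; turning by less only helps.

Besides the angle, only the boost parameter `T = log (x_q / |x_p|)` distinguishes pairs of endpoints,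
as `x y = c` there. The curve with `E = 0` runs through the bifurcation sphere and has `T = 0`. For
`T > 0` one takes a small `E > 0`; the curve then crosses a static block, where `dt` may be increased
at will without losing timelikeness, and this makes up for the missing part of `T`. For `T < 0` one
takes `E < 0`, and the other static block (`exists_energy`).

In the coordinates that are regular at the horizons the curve is `x = (E - u') e^φ`,
`y = -(E + u') e^{-φ} / (u + c)`, where `u' = a cos θ` and `φ' = (E + u') K(u) + q`; the function `K`
(`rate`) is smooth across `u = c`, and `q`, a multiple of a smooth function that vanishes for `u ≤ c`,
is the increase of `dt`. The line element along it is computed in `metric_identity`.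
-/

open scoped ContDiff

namespace SdS

/-! ### The radial function `W(u) / (u - c)` -/

/-- With `W(u) = u² V(1/u)` and `c = 1 / rc`, so that `W(c) = 0`, this is the polynomial
`G(u) = W(u) / (u - c)`, written so that it makes sense at the horizon `u = c`, where it is `2 κ`. -/
noncomputable def radialSlope (d : ℕ) (l μ rc u : ℝ) : ℝ :=
  2 * kappa d l μ rc + (u - 1 / rc) * H d μ rc u

theorem sub_mul_sum_succ_mul_pow (n : ℕ) (c u : ℝ) :
    (u - c) * ∑ k ∈ Finset.range (n + 1), ((k : ℝ) + 1) * c ^ k * u ^ (n - k)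
      = ∑ i ∈ Finset.range (n + 2), u ^ i * c ^ (n + 2 - 1 - i) - (n + 2) * c ^ (n + 1) := by
  induction n with
  | zero => simp [Finset.sum_range_succ]; ring
  | succ n ih =>
    have hA : ∑ k ∈ Finset.range (n + 1), ((k : ℝ) + 1) * c ^ k * u ^ (n + 1 - k)
        = u * ∑ k ∈ Finset.range (n + 1), ((k : ℝ) + 1) * c ^ k * u ^ (n - k) := by
      rw [Finset.mul_sum]
      refine Finset.sum_congr rfl fun k hk => ?_
      have : n + 1 - k = (n - k) + 1 := by
        have := Finset.mem_range.1 hk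
        omega
      rw [this, pow_succ]
      ring
    have hB : ∑ i ∈ Finset.range (n + 3), u ^ i * c ^ (n + 3 - 1 - i)
        = u * ∑ i ∈ Finset.range (n + 2), u ^ i * c ^ (n + 2 - 1 - i) + c ^ (n + 2) := by
      rw [Finset.sum_range_succ', Finset.mul_sum]
      congr 1
      · refine Finset.sum_congr rfl fun k hk => ?_
        have : n + 3 - 1 - (k + 1) = n + 2 - 1 - k := by omega
        rw [this, pow_succ]
        ring
      · simp
    rw [Finset.sum_range_succ, hA, show n + 1 + 2 = n + 3 from rfl, hB, mul_add]
    simp only [Nat.sub_self, pow_zero]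
    push_cast
    rw [show n + 2 - 1 = n + 1 from rfl] at *
    linear_combination u * ih

/-- A zero `r` of `V` gives a zero `1 / r` of `W(u) = u² - μ u^d - 1 / l²`. -/
theorem inv_sq_sub {d : ℕ} (hd : 2 ≤ d) {l μ r : ℝ} (hr : 0 < r) (hV : V d l μ r = 0) :
    (1 / r) ^ 2 - μ * (1 / r) ^ d = 1 / l ^ 2 := by
  obtain ⟨n, rfl⟩ : ∃ n, d = n + 2 := ⟨d - 2, by omega⟩
  simp only [V, Nat.add_sub_cancel] at hV
  have h : r ^ 2 * (1 / l ^ 2) = 1 - μ / r ^ n := by linear_combination -hV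
  have hr2 : r ^ 2 ≠ 0 := by positivity
  apply mul_left_cancel₀ hr2
  rw [h, one_div, inv_pow, inv_pow]
  field_simp
  ring

/-- The two quotients of `u² - c²` and `u^d - c^d` by `u - c` make up `G`; here `μ > 0` visibly
pushes `G` below its value for pure de Sitter space. -/
theorem radialSlope_eq {d : ℕ} (hd : 3 ≤ d) {l μ rc : ℝ} (hrc : 0 < rc) (hV : V d l μ rc = 0)
    (u : ℝ) :
    radialSlope d l μ rc u
      = u + 1 / rc - μ * ∑ i ∈ Finset.range d, u ^ i * (1 / rc) ^ (d - 1 - i) := by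
  have hc := inv_sq_sub (by omega) hrc hV
  obtain ⟨n, rfl⟩ : ∃ n, d = n + 2 := ⟨d - 2, by omega⟩
  have k := sub_mul_sum_succ_mul_pow n (1 / rc) u
  have hκ : 2 * kappa (n + 2) l μ rc
      = 2 * (1 / rc) - (n + 2) * μ * (1 / rc) ^ (n + 1) := by
    have e : rc / l ^ 2 = rc * ((1 / rc) ^ 2 - μ * (1 / rc) ^ (n + 2)) := by rw [hc]; ring
    unfold kappa
    rw [e, show n + 2 - 1 = n + 1 from rfl]
    push_cast
    simp only [one_div, inv_pow]
    field_simp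
    ring
  unfold radialSlope H
  rw [hκ, show n + 2 - 1 = n + 1 from rfl, show n + 2 - 2 = n from rfl]
  rw [show n + 2 - 1 = n + 1 from rfl] at k
  linear_combination -μ * k

/-- The only effect of the mass that the argument needs: `G(u)` is strictly below the de Sitter
value `u + c`. -/
theorem radialSlope_lt {d : ℕ} (hd : 3 ≤ d) {l μ rc u : ℝ} (hμ : 0 < μ) (hrc : 0 < rc)
    (hV : V d l μ rc = 0) (hu : 0 ≤ u) : radialSlope d l μ rc u < u + 1 / rc := by
  rw [radialSlope_eq hd hrc hV]
  have : 0 < ∑ i ∈ Finset.range d, u ^ i * (1 / rc) ^ (d - 1 - i) := by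
    refine Finset.sum_pos' (fun i _ => by positivity) ⟨0, by simp; omega, ?_⟩
    rw [pow_zero, one_mul]
    positivity
  have := mul_pos hμ this
  linarith

/-- `G` is concave on `u ≥ 0`, positive at `u = 0` and zero at `u = 1 / rb`, so it is positive in
between. -/
theorem radialSlope_pos {d : ℕ} (hd : 3 ≤ d) {l μ rb rc u : ℝ} (hl : 0 < l) (hμ : 0 < μ)
    (hrb : 0 < rb) (hlt : rb < rc) (hVb : V d l μ rb = 0) (hVc : V d l μ rc = 0)
    (hu : 0 ≤ u) (hub : u < 1 / rb) : 0 < radialSlope d l μ rc u := by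
  have hrc : 0 < rc := hrb.trans hlt
  have hc : 0 < 1 / rc := by positivity
  have hb : 0 < 1 / rb := by positivity
  have hcb : 1 / rc < 1 / rb := one_div_lt_one_div_of_lt hrb hlt
  have h1 := inv_sq_sub (by omega) hrc hVc
  have h2 := inv_sq_sub (by omega) hrb hVb
  simp only [radialSlope_eq hd hrc hVc]
  generalize 1 / rc = c at *
  generalize 1 / rb = b at *
  -- the value at `b` vanishes
  have hGb : b + c - μ * ∑ i ∈ Finset.range d, b ^ i * c ^ (d - 1 - i) = 0 := by
    have := geom_sum₂_mul b c d
    have hne : b - c ≠ 0 := by linarith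
    apply mul_right_cancel₀ hne
    linear_combination (-μ) * this + h2 - h1
  -- the value at `0` is positive
  have hG0 : 0 < c - μ * c ^ (d - 1) := by
    obtain ⟨n, rfl⟩ : ∃ n, d = n + 1 := ⟨d - 1, by omega⟩
    have : c * (c - μ * c ^ n) = 1 / l ^ 2 := by rw [← h1]; ring
    have h3 : 0 < c * (c - μ * c ^ n) := by rw [this]; positivity
    exact pos_of_mul_pos_right h3 hc.le
  -- `u = t b` is a convex combination of `0` and `b`, and `u ↦ u ^ i` is convex
  set t := u / b with ht
  have ht0 : 0 ≤ t := by positivity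
  have ht1 : t < 1 := (div_lt_one hb).2 hub
  have hut : u = t * b := by rw [ht]; field_simp
  have hS : ∑ i ∈ Finset.range d, u ^ i * c ^ (d - 1 - i)
      ≤ t * ∑ i ∈ Finset.range d, b ^ i * c ^ (d - 1 - i) + (1 - t) * c ^ (d - 1) := by
    obtain ⟨n, rfl⟩ : ∃ n, d = n + 1 := ⟨d - 1, by omega⟩
    rw [Finset.sum_range_succ', Finset.sum_range_succ', mul_add, Finset.mul_sum]
    have : ∑ k ∈ Finset.range n, u ^ (k + 1) * c ^ (n + 1 - 1 - (k + 1))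
        ≤ ∑ k ∈ Finset.range n, t * (b ^ (k + 1) * c ^ (n + 1 - 1 - (k + 1))) := by
      refine Finset.sum_le_sum fun k _ => ?_
      rw [hut, mul_pow, ← mul_assoc]
      have : t ^ (k + 1) ≤ t := pow_le_of_le_one ht0 ht1.le (by omega)
      gcongr
    simp only [pow_zero, Nat.sub_zero]
    linarith
  have := mul_le_mul_of_nonneg_left hS hμ.le
  have h4 := mul_pos (sub_pos.2 ht1) hG0
  have h5 : t * (b + c) = t * (μ * ∑ i ∈ Finset.range d, b ^ i * c ^ (d - 1 - i)) := by
    rw [show b + c = μ * ∑ i ∈ Finset.range d, b ^ i * c ^ (d - 1 - i) by linarith]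
  linarith

theorem kappa_pos {d : ℕ} (hd : 3 ≤ d) {l μ rb rc : ℝ} (hl : 0 < l) (hμ : 0 < μ)
    (hrb : 0 < rb) (hlt : rb < rc) (hVb : V d l μ rb = 0) (hVc : V d l μ rc = 0) :
    0 < kappa d l μ rc := by
  have hrc : 0 < rc := hrb.trans hlt
  have := radialSlope_pos hd hl hμ hrb hlt hVb hVc (u := 1 / rc) (by positivity)
    (one_div_lt_one_div_of_lt hrb hlt)
  simp only [radialSlope, sub_self, zero_mul, add_zero] at this
  linarith

/-! ### The line element along the connecting curve -/

/-- The `x`-velocity of the connecting curve, up to the factor `e^φ`. Here `w = u'`, `f = φ'` and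
`x = (E - w) e^φ`. -/
theorem dx_identity {κ h c u w E q G f : ℝ} (hG0 : G ≠ 0) (huc : u + c ≠ 0)
    (hG : G = 2 * κ + (u - c) * h) (hw : w ^ 2 = E ^ 2 + c ^ 2 - u ^ 2)
    (hf : f = (E + w) * (-(κ + u * h) / ((u + c) * G)) + q) :
    u + f * (E - w) = κ * (u + c) / G + q * (E - w) := by
  have : u + (E + w) * (-(κ + u * h) / ((u + c) * G)) * (E - w) = κ * (u + c) / G := by
    field_simp
    rw [hG]
    linear_combination (κ + u * h) * hw
  rw [hf]
  linear_combination this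

/-- The part of the conformal line element tangent to the `(x, y)`-plane, along the connecting
curve. Here `w = u'`, `f = φ'`, `x = (E - w) e^φ` and `y = Y e^{-φ}`. For `q = 0` only the first
term is left; that choice is `dt/dθ = E / W(u)` in static coordinates. -/
theorem metric_identity {κ h c u w E q G f Y dY : ℝ} (hκ : κ ≠ 0) (hG0 : G ≠ 0) (huc : u + c ≠ 0)
    (hG : G = 2 * κ + (u - c) * h) (hw : w ^ 2 = E ^ 2 + c ^ 2 - u ^ 2)
    (hf : f = (E + w) * (-(κ + u * h) / ((u + c) * G)) + q)
    (hY : Y = -(E + w) / (u + c)) (hdY : dY = u / (u + c) + (E + w) * w / (u + c) ^ 2) :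
    2 / κ * (u + f * (E - w)) * (dY - f * Y) + h * Y ^ 2 * (u + f * (E - w)) ^ 2 / κ ^ 2
      = (u + c) / G + 2 * E * q / κ + (u - c) * G * q ^ 2 / κ ^ 2 := by
  have hD : dY - f * Y = 1 / 2 - h * (E + w) ^ 2 / (2 * (u + c) * G) + q * (E + w) / (u + c) := by
    rw [hf, hY, hdY]
    field_simp
    rw [hG]
    linear_combination (2 * κ + (u - c) * h) * hw
  rw [hD, dx_identity hG0 huc hG hw hf, hY]
  have hE : (E - w) * (E + w) = (u - c) * (u + c) := by linear_combination -hw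
  set Z := (u + c) / G + q * (E - w) / κ with hZ
  have hA : κ * (u + c) / G + q * (E - w) = κ * Z := by
    rw [hZ]
    field_simp
  -- `Z` times the bracket below is the line element; the bracket collapses by `hE`
  have hB : 1 - h * (E + w) ^ 2 / ((u + c) * G) + 2 * q * (E + w) / (u + c)
      + h * (E + w) ^ 2 / (u + c) ^ 2 * Z = 1 + q * (E + w) * G / (κ * (u + c)) := by
    rw [hZ]
    field_simp
    rw [hG]
    linear_combination q * h * (E + w) * (2 * κ + (u - c) * h) * hE
  calc _ = Z * (1 - h * (E + w) ^ 2 / ((u + c) * G) + 2 * q * (E + w) / (u + c)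
      + h * (E + w) ^ 2 / (u + c) ^ 2 * Z) := by
        rw [hA]
        field_simp
    _ = (u + c) / G + 2 * E * q / κ + (u - c) * G * q ^ 2 / κ ^ 2 := by
        rw [hB, hZ]
        field_simp
        linear_combination q ^ 2 * G ^ 2 * hE

/-! ### Primitives and great circles -/

/-- A smooth function on a compact interval has a smooth primitive there, one-sided derivatives at
the endpoints included. -/
theorem exists_primitive {f : ℝ → ℝ} {a b : ℝ} (hab : a < b)
    (hf : ContDiffOn ℝ ∞ f (Set.Icc a b)) (y : ℝ) :
    ∃ F : ℝ → ℝ, ContDiffOn ℝ ∞ F (Set.Icc a b) ∧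
      (∀ x ∈ Set.Icc a b, HasDerivWithinAt F (f x) (Set.Icc a b) x) ∧
      F a = y ∧ F b = y + ∫ x in a..b, f x := by
  -- extending by constants makes the integrand continuous on the whole line
  set g : ℝ → ℝ := Set.IccExtend hab.le ((Set.Icc a b).domRestrict f) with hg
  have hgc : Continuous g := hf.continuousOn.domRestrict.Icc_extend'
  have hgf : ∀ x ∈ Set.Icc a b, g x = f x := fun x hx => Set.IccExtend_of_mem hab.le _ hx
  set F : ℝ → ℝ := fun x => y + ∫ z in a..x, g z with hF
  have hd : ∀ x ∈ Set.Icc a b, HasDerivWithinAt F (f x) (Set.Icc a b) x := by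
    intro x hx
    rw [← hgf x hx]
    exact ((hgc.integral_hasStrictDerivAt a x).hasDerivAt.const_add y).hasDerivWithinAt
  have hu := uniqueDiffOn_Icc hab
  refine ⟨F, ?_, hd, by simp [hF], ?_⟩
  · rw [contDiffOn_infty_iff_derivWithin hu]
    exact ⟨fun x hx => (hd x hx).differentiableWithinAt,
      hf.congr fun x hx => (hd x hx).derivWithin (hu x hx)⟩
  · simp only [hF]
    congr 1
    refine intervalIntegral.integral_congr fun x hx => hgf x ?_
    rwa [Set.uIcc_of_le hab.le] at hx

open Real in
/-- Any two points of the unit sphere are the endpoints of an arc of a great circle, run through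
in time `π` at constant speed at most `1`. -/
theorem exists_great_circle {d : ℕ} (hd : 2 ≤ d) {p q : EuclideanSpace ℝ (Fin d)}
    (hp : ‖p‖ = 1) (hq : ‖q‖ = 1) :
    ∃ σ dσ : ℝ → EuclideanSpace ℝ (Fin d), ContDiff ℝ ∞ σ ∧ (∀ θ, HasDerivAt σ (dσ θ) θ) ∧
      σ 0 = p ∧ σ π = q ∧ (∀ θ, ‖σ θ‖ = 1) ∧ ∀ θ, ‖dσ θ‖ ≤ 1 := by
  set α := arccos (inner ℝ p q) with hα
  have hin := abs_le.1 (abs_real_inner_le_norm p q)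
  rw [hp, hq, one_mul] at hin
  have hcos : cos α = inner ℝ p q := cos_arccos hin.1 hin.2
  obtain ⟨e, he, hpe, hqe⟩ : ∃ e : EuclideanSpace ℝ (Fin d), ‖e‖ = 1 ∧ inner ℝ p e = 0 ∧
      q = cos α • p + sin α • e := by
    set w := q - cos α • p with hw
    have hpw : inner ℝ p w = 0 := by
      rw [hw, inner_sub_right, inner_smul_right, real_inner_self_eq_norm_sq, hp, hcos]
      ring
    have hww : ‖w‖ = sin α := by
      have h1 : ‖w‖ ^ 2 = sin α ^ 2 := by
        rw [hw, norm_sub_sq_real, norm_smul, inner_smul_right, real_inner_comm, ← hcos, hp, hq,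
          Real.norm_eq_abs, mul_one, sq_abs, sin_sq]
        ring
      exact (pow_left_inj₀ (norm_nonneg _) (sin_nonneg_of_nonneg_of_le_pi (arccos_nonneg _)
        (arccos_le_pi _)) two_ne_zero).1 h1
    by_cases h0 : w = 0
    · have hs : sin α = 0 := by rw [← hww, h0, norm_zero]
      -- `q = ± p`: any unit vector orthogonal to `p` will do
      have : Nontrivial (ℝ ∙ p)ᗮ := by
        apply Module.nontrivial_of_finrank_pos (R := ℝ)
        have h1 := (ℝ ∙ p).finrank_add_finrank_orthogonal
        have h2 := finrank_span_singleton (K := ℝ) (v := p) (by rintro rfl; simp at hp)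
        rw [finrank_euclideanSpace_fin] at h1
        omega
      obtain ⟨e, he⟩ := exists_norm_eq (ℝ ∙ p)ᗮ zero_le_one
      refine ⟨e, he, Submodule.mem_orthogonal_singleton_iff_inner_right.1 e.2, ?_⟩
      rw [hs, zero_smul, add_zero]
      exact sub_eq_zero.1 h0
    · have hs : sin α ≠ 0 := by rw [← hww]; exact norm_ne_zero_iff.2 h0
      refine ⟨(sin α)⁻¹ • w, ?_, ?_, ?_⟩
      · rw [norm_smul, norm_inv, hww, Real.norm_eq_abs, ← hww, abs_norm, hww, inv_mul_cancel₀ hs]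
      · rw [inner_smul_right, hpw, mul_zero]
      · rw [smul_inv_smul₀ hs, hw]
        abel
  have hnorm : ∀ A B : ℝ, ‖A • p + B • e‖ ^ 2 = A ^ 2 + B ^ 2 := by
    intro A B
    rw [norm_add_sq_real, inner_smul_left, inner_smul_right, hpe, norm_smul, norm_smul, hp, he]
    simp
  have hk0 : 0 ≤ α / π := div_nonneg (arccos_nonneg _) pi_pos.le
  have hk1 : α / π ≤ 1 := (div_le_one pi_pos).2 (arccos_le_pi _)
  refine ⟨fun θ => cos (α / π * θ) • p + sin (α / π * θ) • e,
    fun θ => (-sin (α / π * θ) * (α / π)) • p + (cos (α / π * θ) * (α / π)) • e,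
    by fun_prop, fun θ => ?_, by simp, ?_, fun θ => ?_, fun θ => ?_⟩
  · have h : HasDerivAt (fun θ : ℝ => α / π * θ) (α / π) θ := by
      simpa using (hasDerivAt_id θ).const_mul (α / π)
    exact (h.cos.smul_const p).add (h.sin.smul_const e)
  · simp only [div_mul_cancel₀ α pi_ne_zero]
    exact hqe.symm
  · have := hnorm (cos (α / π * θ)) (sin (α / π * θ))
    rw [cos_sq_add_sin_sq] at this
    nlinarith [norm_nonneg (cos (α / π * θ) • p + sin (α / π * θ) • e)]
  · rw [← sq_le_one_iff₀ (norm_nonneg _), hnorm]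
    have : (-sin (α / π * θ) * (α / π)) ^ 2 + (cos (α / π * θ) * (α / π)) ^ 2 = (α / π) ^ 2 := by
      linear_combination (α / π) ^ 2 * sin_sq_add_cos_sq (α / π * θ)
    rw [this]
    exact pow_le_one₀ hk0 hk1

/-! ### The parameters of the curve -/

open Real in
/-- The parameters of the connecting curve can be chosen so that the total growth of `log |x|` is
any prescribed `T`. For `T = 0` the curve passes through the bifurcation sphere. For `T > 0` a small
`E > 0` produces less than `T`, and the remainder is supplied by staying longer in the static block,
which costs nothing; `T < 0` is the mirror image. -/
theorem exists_energy {c b : ℝ} (hc : 0 < c) (hcb : c < b) {K : ℝ → ℝ}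
    (hK : ContinuousOn K (Set.Ico 0 b)) (T : ℝ) :
    ∃ a E m : ℝ, 0 < a ∧ a < b ∧ a ^ 2 = c ^ 2 + E ^ 2 ∧ (0 ≤ E ∧ 0 ≤ m ∨ E ≤ 0 ∧ m ≤ 0) ∧
      log (a + E) - log (a - E) + E * (∫ θ in (0 : ℝ)..π, K (a * sin θ))
        + m * (∫ θ in (0 : ℝ)..π, expNegInvGlue (a * sin θ - c)) = T := by
  have hpos : ∀ T : ℝ, 0 < T → ∃ a E m : ℝ, 0 < a ∧ a < b ∧ a ^ 2 = c ^ 2 + E ^ 2 ∧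
      (0 ≤ E ∧ 0 ≤ m) ∧
      log (a + E) - log (a - E) + E * (∫ θ in (0 : ℝ)..π, K (a * sin θ))
        + m * (∫ θ in (0 : ℝ)..π, expNegInvGlue (a * sin θ - c)) = T := by
    intro T hT
    obtain ⟨M, hM⟩ := (isCompact_Icc (a := (0 : ℝ)) (b := (b + c) / 2)).exists_bound_of_continuousOn
      (hK.mono (Set.Icc_subset_Ico_right (by linarith)))
    have hs0 : √(c ^ 2 + (0 : ℝ) ^ 2) = c := by simp [sqrt_sq hc.le]
    have h1 : ContinuousAt (fun E : ℝ => log (√(c ^ 2 + E ^ 2) + E) - log (√(c ^ 2 + E ^ 2) - E)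
        + E * (M * π)) 0 := by
      have hs : ContinuousAt (fun E : ℝ => √(c ^ 2 + E ^ 2)) 0 := by fun_prop
      refine ((ContinuousAt.log (hs.add continuousAt_id) ?_).sub
        (ContinuousAt.log (hs.sub continuousAt_id) ?_)).add (by fun_prop)
      · simpa [sqrt_sq hc.le] using hc.ne'
      · simpa [sqrt_sq hc.le] using hc.ne'
    have h2 : ContinuousAt (fun E : ℝ => √(c ^ 2 + E ^ 2)) 0 := by fun_prop
    have e1 := h1.eventually_lt (g := fun _ => T) continuousAt_const (by simpa using hT)
    have e2 := h2.eventually_lt (g := fun _ => (b + c) / 2) continuousAt_const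
      (by rw [hs0]; linarith)
    obtain ⟨E, ⟨hE1, hE2⟩, hE⟩ :=
      ((Filter.Eventually.filter_mono nhdsWithin_le_nhds (e1.and e2)).and
        (self_mem_nhdsWithin (s := Set.Ioi 0))).exists
    have hE : 0 < E := hE
    set a := √(c ^ 2 + E ^ 2) with ha
    have ha2 : a ^ 2 = c ^ 2 + E ^ 2 := sq_sqrt (by positivity)
    have ha0 : 0 < a := by positivity
    have hca : c < a := by nlinarith
    have hN : 0 < ∫ θ in (0 : ℝ)..π, expNegInvGlue (a * sin θ - c) := by
      refine intervalIntegral.integral_pos pi_pos ?_ (fun θ _ => expNegInvGlue.nonneg _)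
        ⟨π / 2, ⟨by positivity, by linarith [pi_pos]⟩, ?_⟩
      · exact ((expNegInvGlue.contDiff (n := 0)).continuous.comp (by fun_prop)).continuousOn
      · rw [sin_pi_div_two]
        exact expNegInvGlue.pos_of_pos (by linarith)
    have hI : (∫ θ in (0 : ℝ)..π, K (a * sin θ)) ≤ M * π := by
      have := intervalIntegral.norm_integral_le_of_norm_le_const (a := 0) (b := π)
        (f := fun θ => K (a * sin θ)) (C := M) (fun θ hθ => by
          rw [Set.uIoc_of_le pi_pos.le] at hθ
          have := sin_nonneg_of_nonneg_of_le_pi hθ.1.le hθ.2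
          exact hM _ ⟨by positivity, by nlinarith [sin_le_one θ]⟩)
      rw [sub_zero, abs_of_pos pi_pos] at this
      exact (le_abs_self _).trans this
    -- `m` is the quotient of what is missing from `T` by the integral `hN` of the
    -- part supported in the static block
    refine ⟨a, E, (T - (log (a + E) - log (a - E) + E * ∫ θ in (0 : ℝ)..π, K (a * sin θ)))
      / ∫ θ in (0 : ℝ)..π, expNegInvGlue (a * sin θ - c), ha0, by linarith, ha2,
      ⟨hE.le, div_nonneg ?_ hN.le⟩, ?_⟩
    · have := mul_le_mul_of_nonneg_left hI hE.le
      linarith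
    · rw [div_mul_cancel₀ _ hN.ne']
      ring
  rcases lt_trichotomy T 0 with hT | rfl | hT
  · obtain ⟨a, E, m, ha, hab, ha2, ⟨hE, hm⟩, h⟩ := hpos (-T) (by linarith)
    refine ⟨a, -E, -m, ha, hab, by rw [ha2]; ring, .inr ⟨by linarith, by linarith⟩, ?_⟩
    rw [sub_neg_eq_add, ← sub_eq_add_neg]
    linarith
  · exact ⟨c, 0, 0, hc, hcb, by ring, .inl ⟨le_rfl, le_rfl⟩, by simp⟩
  · obtain ⟨a, E, m, ha, hab, ha2, hs, h⟩ := hpos T hT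
    exact ⟨a, E, m, ha, hab, ha2, .inl hs, h⟩

open Real in
/-- The integrand is odd under `θ ↦ π - θ`: the contributions to `φ` of the two halves of the curve,
`u` increasing and `u` decreasing, cancel. -/
theorem integral_cos_mul_comp_sin (K : ℝ → ℝ) :
    ∫ θ in (0 : ℝ)..π, cos θ * K (sin θ) = 0 := by
  have h := intervalIntegral.integral_comp_sub_left (a := 0) (b := π)
    (fun θ => cos θ * K (sin θ)) π
  simp only [cos_pi_sub, sin_pi_sub, sub_self, sub_zero, neg_mul,
    intervalIntegral.integral_neg] at h
  linarith

/-! ### The connecting curve -/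

/-- The coefficient `K(u) = κ / W(u) - u / (u² - c²)`, with its removable singularity at the
horizon `u = c` removed: along the curve with `dt/dθ = E / W(u)`, the exponent `φ` in
`x = (E - u') e^φ` grows at the rate `(E + u') K(u)`. -/
noncomputable def rate (d : ℕ) (l μ rc u : ℝ) : ℝ :=
  -(kappa d l μ rc + u * H d μ rc u) / ((u + 1 / rc) * radialSlope d l μ rc u)

theorem contDiff_H (d : ℕ) (μ rc : ℝ) : ContDiff ℝ ∞ (H d μ rc) := by
  unfold H
  fun_prop

theorem contDiff_radialSlope (d : ℕ) (l μ rc : ℝ) : ContDiff ℝ ∞ (radialSlope d l μ rc) := by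
  have := contDiff_H d μ rc
  unfold radialSlope
  fun_prop

theorem contDiffOn_rate {d : ℕ} {l μ rc : ℝ} {s : Set ℝ}
    (h : ∀ u ∈ s, u + 1 / rc ≠ 0 ∧ radialSlope d l μ rc u ≠ 0) :
    ContDiffOn ℝ ∞ (rate d l μ rc) s := by
  have h1 := contDiff_H d μ rc
  have h2 := contDiff_radialSlope d l μ rc
  unfold rate
  exact ContDiffOn.div (by fun_prop) (by fun_prop) fun u hu => mul_ne_zero (h u hu).1 (h u hu).2

/-- The velocity of the connecting curve is future-directed timelike. Here `w = u'`, `f = φ'`, and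
`e`, `e'` stand for `e^φ`, `e^{-φ}`. Since `(u + c) / G(u) > 1`, the motion in the `(x, y)`-plane
beats any angular motion of speed at most `1`. -/
theorem isFutureTimelike_of_profile {d : ℕ} {l μ rc u w E q f e e' : ℝ}
    {n τ : EuclideanSpace ℝ (Fin d)} (hκ : 0 < kappa d l μ rc) (hG : 0 < radialSlope d l μ rc u)
    (hGu : radialSlope d l μ rc u < u + 1 / rc) (hw : w ^ 2 = E ^ 2 + (1 / rc) ^ 2 - u ^ 2)
    (hf : f = (E + w) * rate d l μ rc u + q) (he : 0 < e) (hee : e * e' = 1) (hEq : 0 ≤ E * q)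
    (hq : 0 ≤ (u - 1 / rc) * q ^ 2) (hx : 0 ≤ q * (E - w)) (hτ : ‖τ‖ ≤ 1) :
    IsFutureTimelike d l μ rc ((E - w) * e, -(E + w) / (u + 1 / rc) * e', n)
      ((u + f * (E - w)) * e,
        (u / (u + 1 / rc) + (E + w) * w / (u + 1 / rc) ^ 2 - f * (-(E + w) / (u + 1 / rc))) * e',
        τ) := by
  have huc : 0 < u + 1 / rc := hG.trans hGu
  have hmi := metric_identity hκ.ne' hG.ne' huc.ne' rfl hw hf rfl rfl
  have hdx := dx_identity hG.ne' huc.ne' rfl hw hf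
  have hxy : invR rc (((E - w) * e, -(E + w) / (u + 1 / rc) * e', n) : Ambient d) = u := by
    have h : (E - w) * (-(E + w) / (u + 1 / rc)) = 1 / rc - u := by
      field_simp [huc.ne']
      linear_combination hw
    simp only [invR]
    linear_combination -((E - w) * (-(E + w) / (u + 1 / rc))) * hee - h
  constructor
  · have hτ2 : ‖τ‖ ^ 2 ≤ 1 := pow_le_one₀ (norm_nonneg _) hτ
    have h1 : 1 < (u + 1 / rc) / radialSlope d l μ rc u := (one_lt_div hG).2 hGu
    have h2 : 0 ≤ 2 * E * q / kappa d l μ rc := div_nonneg (by linarith) hκ.le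
    have h3 : 0 ≤ (u - 1 / rc) * radialSlope d l μ rc u * q ^ 2 / kappa d l μ rc ^ 2 := by
      rw [mul_right_comm]
      positivity
    rw [conformalMetric, hxy]
    refine lt_of_lt_of_eq (sub_pos.2 (hτ2.trans_lt (b := 1) (c := _ + _ + _) (by linarith)))
      (congrArg (· - ‖τ‖ ^ 2) (hmi.symm.trans ?_))
    -- the two exponential factors cancel in each term
    generalize -(E + w) / (u + 1 / rc) = Y
    generalize u / (u + 1 / rc) + (E + w) * w / (u + 1 / rc) ^ 2 - f * Y = Z
    generalize u + f * (E - w) = A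
    linear_combination (-2 / kappa d l μ rc * A * Z
      - H d μ rc u * Y ^ 2 * A ^ 2 / kappa d l μ rc ^ 2 * (1 + e * e')) * hee
  · change 0 < (u + f * (E - w)) * e
    rw [hdx]
    exact mul_pos (add_pos_of_pos_of_nonneg (div_pos (mul_pos hκ huc) hG) hx) he

/-- A curve parametrised by the angle `θ ∈ [0, π]` is brought to the parameter interval `[0, 1]`. -/
theorem isTimelikeCurve_comp_pi_mul {d : ℕ} {l μ rb rc : ℝ} {Γ v : ℝ → Ambient d} {p q : Ambient d}
    (hp : p ∈ scriMinus d rc) (hq : q ∈ scriPlus d rc)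
    (hΓ : ContDiffOn ℝ ∞ Γ (Set.Icc 0 Real.pi))
    (hd : ∀ θ ∈ Set.Icc 0 Real.pi, HasDerivWithinAt Γ (v θ) (Set.Icc 0 Real.pi) θ)
    (h0 : Γ 0 = p) (h1 : Γ Real.pi = q)
    (hm : ∀ θ ∈ Set.Ioo 0 Real.pi, Γ θ ∈ spacetime d rb rc)
    (ht : ∀ θ ∈ Set.Icc 0 Real.pi, IsFutureTimelike d l μ rc (Γ θ) (v θ)) :
    IsTimelikeCurve d l μ rb rc (fun s => Γ (Real.pi * s)) p q := by
  have hpi := Real.pi_pos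
  have hmaps : Set.MapsTo (fun s : ℝ => Real.pi * s) (Set.Icc 0 1) (Set.Icc 0 Real.pi) :=
    fun s hs => ⟨mul_nonneg hpi.le hs.1, by nlinarith [hs.2]⟩
  have hmem : ∀ s ∈ Set.Ioo (0 : ℝ) 1, Γ (Real.pi * s) ∈ spacetime d rb rc :=
    fun s hs => hm _ ⟨mul_pos hpi hs.1, by nlinarith [hs.2]⟩
  refine ⟨hΓ.comp (by fun_prop) hmaps, by simpa using h0, by simpa using h1, ?_, hmem, ?_⟩
  · intro s hs
    rcases eq_or_lt_of_le hs.1 with rfl | h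
    · exact .inr (.inl (by simpa [h0] using hp))
    rcases eq_or_lt_of_le hs.2 with rfl | h'
    · exact .inr (.inr (by simpa [h1] using hq))
    exact .inl (hmem s ⟨h, h'⟩)
  · intro s hs
    have hlin : HasDerivWithinAt (fun s : ℝ => Real.pi * s) Real.pi (Set.Icc 0 1) s := by
      simpa using ((hasDerivAt_id s).const_mul Real.pi).hasDerivWithinAt
    have h := ((hd _ (hmaps hs)).scomp s hlin hmaps).derivWithin
      (uniqueDiffOn_Icc zero_lt_one s hs)
    change IsFutureTimelike d l μ rc (Γ (Real.pi * s))
      (derivWithin (Γ ∘ fun s => Real.pi * s) (Set.Icc 0 1) s)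
    rw [h]
    obtain ⟨h2, h3⟩ := ht _ (hmaps hs)
    refine ⟨?_, mul_pos hpi h3⟩
    have e : conformalMetric d l μ rc (Γ (Real.pi * s)) (Real.pi • v (Real.pi * s))
        = Real.pi ^ 2 * conformalMetric d l μ rc (Γ (Real.pi * s)) (v (Real.pi * s)) := by
      simp only [conformalMetric, Prod.smul_fst, Prod.smul_snd, smul_eq_mul, norm_smul,
        Real.norm_eq_abs, mul_pow, sq_abs]
      ring
    rw [e]
    positivity

theorem penroseProperty {d : ℕ} (hd : 3 ≤ d) {l μ rb rc : ℝ} (hl : 0 < l) (hμ : 0 < μ)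
    (hrb : 0 < rb) (hlt : rb < rc) (hVb : V d l μ rb = 0) (hVc : V d l μ rc = 0) :
    PenroseProperty d l μ rb rc := by
  rintro ⟨xp, yp, np⟩ ⟨hpu, hxp, hnp⟩ ⟨xq, yq, nq⟩ ⟨hqu, hxq, hnq⟩
  have hp : (xp, yp, np) ∈ scriMinus d rc := ⟨hpu, hxp, hnp⟩
  have hq : (xq, yq, nq) ∈ scriPlus d rc := ⟨hqu, hxq, hnq⟩
  simp only [invR] at hpu hxp hnp hqu hxq hnq
  have hrc : 0 < rc := hrb.trans hlt
  have hκ := kappa_pos hd hl hμ hrb hlt hVb hVc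
  have hcb : 1 / rc < 1 / rb := one_div_lt_one_div_of_lt hrb hlt
  have hGpos : ∀ u, 0 ≤ u → u < 1 / rb → 0 < radialSlope d l μ rc u :=
    fun u h h' => radialSlope_pos hd hl hμ hrb hlt hVb hVc h h'
  have hGlt : ∀ u, 0 ≤ u → radialSlope d l μ rc u < u + 1 / rc :=
    fun u h => radialSlope_lt hd hμ hrc hVc h
  have hc : 0 < 1 / rc := by positivity
  have hrate : ContDiffOn ℝ ∞ (rate d l μ rc) (Set.Ico 0 (1 / rb)) :=
    contDiffOn_rate fun u hu => ⟨by linarith [hu.1], (hGpos u hu.1 hu.2).ne'⟩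
  obtain ⟨a, E, m, ha, hab, ha2, hEm, hT⟩ := exists_energy hc hcb hrate.continuousOn
    (Real.log xq - Real.log (-xp))
  obtain ⟨σ, dσ, hσ, hdσ, hσ0, hσ1, hσn, hdσn⟩ := exists_great_circle (by omega) hnp hnq
  have hmemdef : ∀ z : Ambient d, z ∈ spacetime d rb rc ↔
      0 < 1 / rc - z.1 * z.2.1 ∧ 1 / rc - z.1 * z.2.1 < 1 / rb ∧ ‖z.2.2‖ = 1 := fun _ => Iff.rfl
  set c := 1 / rc
  have hu : ∀ θ ∈ Set.Icc 0 Real.pi, 0 ≤ a * Real.sin θ ∧ a * Real.sin θ < 1 / rb := by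
    intro θ hθ
    have := Real.sin_nonneg_of_nonneg_of_le_pi hθ.1 hθ.2
    exact ⟨by positivity, by nlinarith [Real.sin_le_one θ]⟩
  have haE : |E| < a := abs_lt_of_sq_lt_sq (by nlinarith) ha.le
  obtain ⟨haE1, haE2⟩ := abs_lt.1 haE
  set f : ℝ → ℝ := fun θ => (E + a * Real.cos θ) * rate d l μ rc (a * Real.sin θ)
    + m * expNegInvGlue (a * Real.sin θ - c) with hf
  have hKc : ContDiffOn ℝ ∞ (fun θ => rate d l μ rc (a * Real.sin θ)) (Set.Icc 0 Real.pi) :=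
    hrate.comp (by fun_prop) hu
  have hBc : ContDiff ℝ ∞ (fun θ => expNegInvGlue (a * Real.sin θ - c)) :=
    expNegInvGlue.contDiff.comp (by fun_prop)
  have hfc : ContDiffOn ℝ ∞ f (Set.Icc 0 Real.pi) := by
    have := hBc.contDiffOn (s := Set.Icc 0 Real.pi)
    fun_prop
  have hint : ∀ {g : ℝ → ℝ}, ContinuousOn g (Set.Icc 0 Real.pi) →
      IntervalIntegrable g MeasureTheory.volume 0 Real.pi := fun hg =>
    ContinuousOn.intervalIntegrable (by rwa [Set.uIcc_of_le Real.pi_pos.le])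
  have hfI : ∫ θ in (0 : ℝ)..Real.pi, f θ
      = E * (∫ θ in (0 : ℝ)..Real.pi, rate d l μ rc (a * Real.sin θ))
        + m * ∫ θ in (0 : ℝ)..Real.pi, expNegInvGlue (a * Real.sin θ - c) := by
    have h1 := hKc.continuousOn
    have h2 := hBc.continuous.continuousOn (s := Set.Icc 0 Real.pi)
    have h3 := integral_cos_mul_comp_sin fun z => a * rate d l μ rc (a * z)
    have e : f = fun θ => E * rate d l μ rc (a * Real.sin θ)
        + Real.cos θ * (a * rate d l μ rc (a * Real.sin θ))
        + m * expNegInvGlue (a * Real.sin θ - c) := by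
      funext θ
      simp only [hf]
      ring
    rw [e, intervalIntegral.integral_add (hint (by fun_prop)) (hint (by fun_prop)),
      intervalIntegral.integral_add (hint (by fun_prop)) (hint (by fun_prop)), h3,
      intervalIntegral.integral_const_mul, intervalIntegral.integral_const_mul, add_zero]
  -- the initial value puts the curve at `x = xp`; `hφ1'` says that it ends at `x = xq`
  obtain ⟨φ, hφ, hdφ, hφ0, hφ1⟩ := exists_primitive Real.pi_pos hfc
    (Real.log (-xp) - Real.log (a - E))
  have hφ1' : φ Real.pi = Real.log xq - Real.log (a + E) := by
    rw [hφ1, hfI]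
    linarith
  have hne : ∀ θ ∈ Set.Icc 0 Real.pi, a * Real.sin θ + c ≠ 0 := fun θ hθ => by
    have := (hu θ hθ).1
    positivity
  -- `1 / r = a sin θ` along this curve, by `hxy` below
  set Γ : ℝ → Ambient d := fun θ => ((E - a * Real.cos θ) * Real.exp (φ θ),
    -(E + a * Real.cos θ) / (a * Real.sin θ + c) * Real.exp (-φ θ), σ θ) with hΓ
  set dY : ℝ → ℝ := fun θ => a * Real.sin θ / (a * Real.sin θ + c)
    + (E + a * Real.cos θ) * (a * Real.cos θ) / (a * Real.sin θ + c) ^ 2 with hdY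
  set v : ℝ → Ambient d := fun θ =>
    ((a * Real.sin θ + f θ * (E - a * Real.cos θ)) * Real.exp (φ θ),
    (dY θ - f θ * (-(E + a * Real.cos θ) / (a * Real.sin θ + c))) * Real.exp (-φ θ), dσ θ) with hv
  have hw : ∀ θ, (a * Real.cos θ) ^ 2 = E ^ 2 + c ^ 2 - (a * Real.sin θ) ^ 2 := fun θ => by
    linear_combination a ^ 2 * Real.sin_sq_add_cos_sq θ + ha2
  have hxy : ∀ θ ∈ Set.Icc 0 Real.pi, c - (Γ θ).1 * (Γ θ).2.1 = a * Real.sin θ := by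
    intro θ hθ
    have h1 := hne θ hθ
    have h2 : Real.exp (φ θ) * Real.exp (-φ θ) = 1 := by rw [← Real.exp_add]; simp
    have h3 : (E - a * Real.cos θ) * (-(E + a * Real.cos θ) / (a * Real.sin θ + c))
        = c - a * Real.sin θ := by
      field_simp
      linear_combination hw θ
    simp only [hΓ]
    linear_combination -((E - a * Real.cos θ) * (-(E + a * Real.cos θ) / (a * Real.sin θ + c))) * h2
      - h3
  have hx0 : (E - a) * Real.exp (Real.log (-xp) - Real.log (a - E)) = xp := by
    rw [Real.exp_sub, Real.exp_log (by linarith), Real.exp_log (by linarith)]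
    have : a - E ≠ 0 := by linarith
    field_simp
    ring
  have hx1 : (E + a) * Real.exp (Real.log xq - Real.log (a + E)) = xq := by
    rw [Real.exp_sub, Real.exp_log hxq, Real.exp_log (by linarith)]
    have : a + E ≠ 0 := by linarith
    field_simp
    ring
  refine ⟨_, isTimelikeCurve_comp_pi_mul (Γ := Γ) (v := v) hp hq ?_ ?_ ?_ ?_ ?_ ?_⟩
  · have h1 : ContDiffOn ℝ ∞ (fun θ => -(E + a * Real.cos θ) / (a * Real.sin θ + c))
        (Set.Icc 0 Real.pi) := ContDiffOn.div (by fun_prop) (by fun_prop) hne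
    have h2 := hσ.contDiffOn (s := Set.Icc 0 Real.pi)
    fun_prop
  · intro θ hθ
    have h1 : HasDerivAt (fun θ => E - a * Real.cos θ) (a * Real.sin θ) θ := by
      simpa using ((Real.hasDerivAt_cos θ).const_mul a).const_sub E
    have h2 : HasDerivAt (fun θ => -(E + a * Real.cos θ) / (a * Real.sin θ + c)) (dY θ) θ := by
      have hA := (((Real.hasDerivAt_cos θ).const_mul a).const_add E).fun_neg
      have hB := ((Real.hasDerivAt_sin θ).const_mul a).add_const c
      refine (hA.div hB (hne θ hθ)).congr_deriv ?_
      have := hne θ hθ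
      simp only [hdY]
      field_simp
      ring
    have h3 := hdφ θ hθ
    refine ((h1.hasDerivWithinAt.mul h3.exp).congr_deriv ?_).prodMk
      (((h2.hasDerivWithinAt.mul h3.fun_neg.exp).congr_deriv ?_).prodMk (hdσ θ).hasDerivWithinAt)
    · ring
    · ring
  · have hX : (Γ 0).1 = xp := by
      simp only [hΓ, hφ0, Real.cos_zero, mul_one]
      exact hx0
    have := hxy 0 ⟨le_rfl, Real.pi_pos.le⟩
    rw [hX, Real.sin_zero] at this
    refine Prod.ext hX (Prod.ext (mul_left_cancel₀ hxp.ne ?_) hσ0)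
    linarith
  · have hX : (Γ Real.pi).1 = xq := by
      simp only [hΓ, hφ1', Real.cos_pi, mul_neg, mul_one, sub_neg_eq_add]
      exact hx1
    have := hxy Real.pi ⟨Real.pi_pos.le, le_rfl⟩
    rw [hX, Real.sin_pi] at this
    refine Prod.ext hX (Prod.ext (mul_left_cancel₀ hxq.ne' ?_) hσ1)
    linarith
  · intro θ hθ
    have h1 := Set.Ioo_subset_Icc_self hθ
    rw [hmemdef, hxy θ h1]
    exact ⟨mul_pos ha (Real.sin_pos_of_pos_of_lt_pi hθ.1 hθ.2), (hu θ h1).2, hσn θ⟩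
  · intro θ hθ
    obtain ⟨hu0, hub⟩ := hu θ hθ
    have hG := hGpos _ hu0 hub
    have hGl := hGlt _ hu0
    -- in the static block, that is for `u > c`, the sign of `E - u'` is that of `E`
    have hwE : c ≤ a * Real.sin θ → |a * Real.cos θ| ≤ |E| :=
      fun h => sq_le_sq.1 (by nlinarith [hw θ])
    have hB0 := expNegInvGlue.nonneg (a * Real.sin θ - c)
    have hBz : a * Real.sin θ ≤ c → expNegInvGlue (a * Real.sin θ - c) = 0 := fun h =>
      expNegInvGlue.zero_of_nonpos (sub_nonpos.2 h)
    have hEm' : 0 ≤ E * m := by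
      rcases hEm with ⟨h, h'⟩ | ⟨h, h'⟩
      · exact mul_nonneg h h'
      · exact mul_nonneg_of_nonpos_of_nonpos h h'
    refine isFutureTimelike_of_profile (q := m * expNegInvGlue (a * Real.sin θ - c)) hκ hG hGl
      (hw θ) rfl (Real.exp_pos _) (by rw [← Real.exp_add, add_neg_cancel, Real.exp_zero])
      ?_ ?_ ?_ (hdσn θ)
    · rw [← mul_assoc]
      exact mul_nonneg hEm' hB0
    · rcases le_total (a * Real.sin θ) c with h | h
      · simp [hBz h]
      · exact mul_nonneg (sub_nonneg.2 h) (sq_nonneg _)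
    · rcases le_total (a * Real.sin θ) c with h | h
      · simp [hBz h]
      · have hwE := hwE h
        rcases hEm with ⟨h1, h2⟩ | ⟨h1, h2⟩
        · rw [abs_of_nonneg h1] at hwE
          exact mul_nonneg (mul_nonneg h2 hB0) (sub_nonneg.2 (abs_le.1 hwE).2)
        · rw [abs_of_nonpos h1] at hwE
          exact mul_nonneg_of_nonpos_of_nonpos (mul_nonpos_of_nonpos_of_nonneg h2 hB0)
            (by linarith [(abs_le.1 hwE).1])

end SdS

theorem theorem2p7 (d : ℕ) (hd : 3 ≤ d) (l μ rb rc : ℝ) (hl : 0 < l) (hμ : 0 < μ)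
    (hrc : IsGreatest {r : ℝ | 0 < r ∧ SdS.V d l μ r = 0} rc)
    (hrb : IsGreatest {r : ℝ | 0 < r ∧ r < rc ∧ SdS.V d l μ r = 0} rb) :
    SdS.PenroseProperty d l μ rb rc :=
  SdS.penroseProperty hd hl hμ hrb.1.1 hrb.1.2.1 hrb.1.2.2 hrc.1.2
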